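/- Let $p\in(1,\infty)$, $c\in(0,2]$, $\lambda>0$, and let $(G,d)$ be a complete $p$-uniformly convex metric space with constant $c$; that is, any two points of $G$ are joined by a geodesic, and $$d(z,(1-t)x\oplus ty)^p\le(1-t)\,d(z,x)^p+t\,d(z,y)^p-\tfrac c2\,t(1-t)\,d(x,y)^p\qquad(x,y,z\in G,\ t\in[0,1]),$$ where $(1-t)x\oplus ty$ is the point at parameter $t$ on a constant-speed geodesic from $x$ to $y$. Let $f\colon G\to\mathbb R\cup\{+\infty\}$ be proper, convex (along geodesics) and lower semicontinuous. Then for every $x\in G$ the function $y\mapsto f(y)+\frac{1}{p\lambda^{p-1}}d(y,x)^p$ has a unique minimizer over $G$, denoted $T(x)=\operatorname{prox}^p_{f,\lambda}(x)$. For $a>0$ write $$\psi_T^{(p,a)}(x,y)=\tfrac a2\bigl(d(Tx,x)^p+d(Ty,y)^p+d(Tx,Ty)^p+d(x,y)^p-d(Tx,y)^p-d(x,Ty)^p\bigr).$$ (i) Suppose that $G$ is symmetric perpendicular, i.e. for all geodesic segments $\gamma,\eta$ with a common point $q$ one has $\gamma\perp_q\eta\iff\eta\perp_q\gamma$, where $\gamma\perp_q\eta$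 means $d(x,q)\le d(x,y)$ for all $x\in\gamma$, $y\in\eta$. Then $\operatorname{argmin} f=\operatorname{Fix}T$, and $T$ is quasi strictly nonexpansive: $d(Tx,\bar x)<d(x,\bar x)$ for all $\bar x\in\operatorname{Fix}T$ and all $x\in G\setminus\operatorname{Fix}T$. (ii) If $c>1$, then $T$ is pointwise almost $\alpha$-firmly nonexpansive at every $y\in\operatorname{argmin}f$ on $G$ with constant $\alpha_c=\frac{c(c-1)}{c(c-1)+2}$ and violation (at most) $\epsilon_c=\frac{2-c}{c-1}$; that is, $\alpha_c\in(0,1)$, $\epsilon_c\ge 0$, and for all $x\in G$ $$d(Tx,Ty)^p\le(1+\epsilon_c)\,d(x,y)^p-\tfrac{1-\alpha_c}{\alpha_c}\,\psi_T^{(p,c)}(x,y).$$ (iii) If $G$ is a CAT$(\kappa)$ space for some $\kappa\in\mathbb R$, then $T$ is pointwise asymptotically $\alpha$-firmly nonexpansive at every $y\in\operatorname{argmin}f$ with constant $\bar\alpha=\frac12$; that is, for every $c'\in(0,2]$ (in particular for $c'=c$) and every $\epsilon>0$ there is a neighborhood $U$ of $y$ such that for all $x\in U$ $$d(Tx,Ty)^p\le(1+\epsilon)\,d(x,y)^p-\tfrac{1-\bar\alpha}{\bar\alpha}\,\psi_T^{(p,c')}(x,y).$$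 -/

import Mathlib

open Set Filter Topology

noncomputable section

namespace PProx

/-- `γ`, restricted to `[0,1]`, is a constant-speed minimal geodesic from `x` to `y`;
the point `γ t` is then a point `(1-t)x ⊕ ty`. -/
def IsGeodesic {G : Type*} [MetricSpace G] (γ : ℝ → G) (x y : G) : Prop :=
  γ 0 = x ∧ γ 1 = y ∧
    ∀ s ∈ Icc (0 : ℝ) 1, ∀ t ∈ Icc (0 : ℝ) 1, dist (γ s) (γ t) = |s - t| * dist x y

/-- `G` is a geodesic space and
`d(z, (1-t)x ⊕ ty)^p ≤ (1-t) d(z,x)^p + t d(z,y)^p - (c/2) t (1-t) d(x,y)^p`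
along every geodesic. -/
def PUniformlyConvex (G : Type*) [MetricSpace G] (p c : ℝ) : Prop :=
  (∀ x y : G, ∃ γ : ℝ → G, IsGeodesic γ x y) ∧
    ∀ (x y z : G) (γ : ℝ → G), IsGeodesic γ x y → ∀ t ∈ Icc (0 : ℝ) 1,
      dist z (γ t) ^ p ≤
        (1 - t) * dist z x ^ p + t * dist z y ^ p - c / 2 * t * (1 - t) * dist x y ^ p

/-- `S` is the image of a geodesic segment. -/
def IsGeodesicSegment {G : Type*} [MetricSpace G] (S : Set G) : Prop :=
  ∃ (x y : G) (γ : ℝ → G), IsGeodesic γ x y ∧ S = γ '' Icc (0 : ℝ) 1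

/-- `S ⊥_q S'`. -/
def PerpAt {G : Type*} [MetricSpace G] (S S' : Set G) (q : G) : Prop :=
  ∀ x ∈ S, ∀ y ∈ S', dist x q ≤ dist x y

def SymmetricPerpendicular (G : Type*) [MetricSpace G] : Prop :=
  ∀ S S' : Set G, IsGeodesicSegment S → IsGeodesicSegment S' →
    ∀ q ∈ S ∩ S', PerpAt S S' q ↔ PerpAt S' S q

/-- Proper: never `-∞`, not identically `+∞`. -/
def ProperFun {G : Type*} (f : G → EReal) : Prop :=
  (∀ x, f x ≠ ⊥) ∧ ∃ x, f x ≠ ⊤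

/-- Convexity along all geodesics. -/
def GeodesicallyConvex {G : Type*} [MetricSpace G] (f : G → EReal) : Prop :=
  ∀ (x y : G) (γ : ℝ → G), IsGeodesic γ x y → ∀ t ∈ Icc (0 : ℝ) 1,
    f (γ t) ≤ ((1 - t : ℝ) : EReal) * f x + (t : EReal) * f y

/-- The set of global minimizers. -/
def argmin {G : Type*} (g : G → EReal) : Set G :=
  {y | ∀ z, g y ≤ g z}

/-- The argmin set that defines the `p`-proximal mapping of `f` with parameter `lam` at `x`. -/
def proxSet {G : Type*} [MetricSpace G] (p lam : ℝ) (f : G → EReal) (x : G) : Set G :=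
  argmin fun y => f y + ((1 / (p * lam ^ (p - 1)) * dist y x ^ p : ℝ) : EReal)

/-- `T` is the `p`-proximal mapping of `f`: at every `x` the argmin set is the singleton `{T x}`. -/
def IsProx {G : Type*} [MetricSpace G] (p lam : ℝ) (f : G → EReal) (T : G → G) : Prop :=
  ∀ x, proxSet p lam f x = {T x}

/-- The transport discrepancy `ψ_T^{(p,c)}(x,y)`. -/
def transportDiscrepancy {G : Type*} [MetricSpace G] (p c : ℝ) (T : G → G) (x y : G) : ℝ :=
  c / 2 * (dist (T x) x ^ p + dist (T y) y ^ p + dist (T x) (T y) ^ p + dist x y ^ p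
    - dist (T x) y ^ p - dist x (T y) ^ p)

/-- Strict decrease of the distance to every fixed point, at every point that is not itself fixed
(at a fixed point the strict inequality is never possible). -/
def QuasiStrictlyNonexpansive {G : Type*} [MetricSpace G] (T : G → G) : Prop :=
  ∀ x ∉ Function.fixedPoints T, ∀ y ∈ Function.fixedPoints T, dist (T x) y < dist x y

/-- `T` is pointwise almost `α`-firmly nonexpansive at `y ∈ D` on `D`, with constant `α` and
violation (at most) `ε`. -/
def AlmostFirmlyNonexpansiveAt {G : Type*} [MetricSpace G] (p c α ε : ℝ) (T : G → G)
    (D : Set G) (y : G) : Prop :=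
  α ∈ Ioo (0 : ℝ) 1 ∧ 0 ≤ ε ∧ y ∈ D ∧ ∀ x ∈ D,
    dist (T x) (T y) ^ p ≤
      (1 + ε) * dist x y ^ p - (1 - α) / α * transportDiscrepancy p c T x y

/-- `T` is pointwise asymptotically `α`-firmly nonexpansive at `y` with constant `α`. -/
def AsymptoticallyFirmlyNonexpansiveAt {G : Type*} [MetricSpace G] (p c α : ℝ) (T : G → G)
    (y : G) : Prop :=
  α ∈ Ioo (0 : ℝ) 1 ∧ ∀ ε > 0, ∃ U ∈ 𝓝 y, ∀ x ∈ U,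
    dist (T x) (T y) ^ p ≤
      (1 + ε) * dist x y ^ p - (1 - α) / α * transportDiscrepancy p c T x y

/-- Triangle comparison of `G` with a model plane `M` with distance function `δ`: every geodesic
triangle with vertices `x, y, z` (of perimeter less than `2π/√κ` if `κ > 0`) has a comparison
triangle `x', y', z'` in `M` such that any two points on two sides of the triangle are at most as
far apart as their comparison points. By relabelling, the two sides may be taken to be those that
meet at `x`. -/
def TriangleComparison (G : Type*) [MetricSpace G] (κ : ℝ) {M : Type} (δ : M → M → ℝ) : Prop :=
  ∀ x y z : G, (0 < κ → √κ * (dist x y + dist y z + dist z x) < 2 * Real.pi) →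
    ∃ x' y' z' : M, δ x' y' = dist x y ∧ δ y' z' = dist y z ∧ δ z' x' = dist z x ∧
      ∀ γ η : ℝ → G, IsGeodesic γ x y → IsGeodesic η x z →
        ∀ s ∈ Icc (0 : ℝ) 1, ∀ t ∈ Icc (0 : ℝ) 1, ∀ u v : M,
          δ x' u = s * dist x y → δ u y' = (1 - s) * dist x y →
          δ x' v = t * dist x z → δ v z' = (1 - t) * dist x z →
          dist (γ s) (η t) ≤ δ u v

/-- The distance of the unit sphere of `ℝ³` with its angular metric, scaled to curvature `κ > 0`. -/
def sphereDist (κ : ℝ) (u v : Metric.sphere (0 : EuclideanSpace ℝ (Fin 3)) 1) : ℝ :=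
  InnerProductGeometry.angle (u : EuclideanSpace ℝ (Fin 3)) v / √κ

/-- The distance of the hyperbolic plane, scaled to curvature `κ < 0`. -/
def hyperbolicDist (κ : ℝ) (u v : UpperHalfPlane) : ℝ :=
  dist u v / √(-κ)

/-- `G` is a CAT(`κ`) space: points at distance less than `π/√κ` (any two points if `κ ≤ 0`) are
joined by a geodesic, and triangle comparison holds with the model plane of curvature `κ`. -/
def IsCAT (G : Type*) [MetricSpace G] (κ : ℝ) : Prop :=
  (∀ x y : G, (0 < κ → √κ * dist x y < Real.pi) → ∃ γ : ℝ → G, IsGeodesic γ x y) ∧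
    (0 < κ → TriangleComparison G κ (sphereDist κ)) ∧
    (κ = 0 → TriangleComparison G κ
      (fun u v : EuclideanSpace ℝ (Fin 2) => dist u v)) ∧
    (κ < 0 → TriangleComparison G κ (hyperbolicDist κ))

end PProx

end

/-!
Adding a multiple of `d(·, x) ^ p` makes `f` uniformly convex, so the midpoints of a minimizing
sequence show that it is Cauchy: the prox point `u = T x` exists and is unique. If `y` minimizes
`f`, then `f` does not increase along a geodesic from `u` to `y`, so `u` is a nearest point to `x`
on that geodesic. Uniform convexity turns this into a Pythagorean inequality with constant `c / 2`
in front of `d(u, y) ^ p`, which gives (ii). Symmetric perpendicularity makes `u` nearest to `y` on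
the geodesic from `u` to `x` as well, which moves the constant to `d(x, u) ^ p` and gives (i).
In a CAT(κ) space, comparison with the model plane gives
`d(u, y) ^ 2 + d(x, u) ^ 2 ≤ (1 + O(d(x, y) ^ 2)) d(x, y) ^ 2`, with both constants equal to `1`,
and since `p`-uniform convexity forces `p ≥ 2` unless the space is a point, raising this to the
power `p / 2` gives (iii).
-/

namespace PProx

section Real

theorem le_of_forall_Ioc_le {F : ℝ → ℝ} {M : ℝ} (hF : ContinuousAt F 0)
    (hle : ∀ t ∈ Ioc (0 : ℝ) 1, F t ≤ M) : F 0 ≤ M :=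
  le_of_tendsto (hF.mono_left nhdsWithin_le_nhds : Tendsto F (𝓝[>] 0) (𝓝 (F 0)))
    (eventually_of_mem (Ioc_mem_nhdsGT zero_lt_one) hle)

theorem add_le_of_forall_le_convexComb {a b k : ℝ}
    (h : ∀ t ∈ Ioc (0 : ℝ) 1, a ≤ (1 - t) * a + t * b - k * t * (1 - t)) : k + a ≤ b := by
  have hF : ContinuousAt (fun t : ℝ => k * (1 - t) + a) 0 := by fun_prop
  have hle : ∀ t ∈ Ioc (0 : ℝ) 1, k * (1 - t) + a ≤ b := fun t ht =>
    le_of_mul_le_mul_left (by linarith [h t ht]) ht.1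
  simpa only [sub_zero, mul_one] using le_of_forall_Ioc_le hF hle

theorem exists_le_mul_rpow_sub_mul {p K b : ℝ} (hp : 1 < p) (hK : 0 < K) (hb : 0 ≤ b) :
    ∃ B : ℝ, ∀ s : ℝ, 0 ≤ s → B ≤ K * s ^ p - b * s := by
  have hp0 : 0 < p := by linarith
  set η := (p * K) ^ p⁻¹
  have hη0 : 0 < η := by positivity
  have hηp : η ^ p = p * K := Real.rpow_inv_rpow (by positivity) hp0.ne'
  refine ⟨-((b / η) ^ p.conjExponent / p.conjExponent), fun s hs => ?_⟩
  have young := Real.young_inequality_of_nonneg (mul_nonneg hη0.le hs) (div_nonneg hb hη0.le)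
    (Real.HolderConjugate.conjExponent hp)
  have hprod : η * s * (b / η) = b * s := by field_simp
  have hpow : (η * s) ^ p / p = K * s ^ p := by
    rw [Real.mul_rpow hη0.le hs, hηp]; field_simp
  rw [hprod, hpow] at young
  linarith

theorem add_coe_le_coe_iff {a : EReal} {s r : ℝ} :
    a + (s : EReal) ≤ r ↔ a ≤ ((r - s : ℝ) : EReal) := by
  rw [EReal.coe_sub]
  exact (EReal.le_sub_iff_add_le (.inl (EReal.coe_ne_bot s)) (.inl (EReal.coe_ne_top s))).symm

end Real

section WellPosed

theorem exists_argmin_eq_singleton {X : Type*} [MetricSpace X] [CompleteSpace X] {g : X → EReal}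
    (hg : LowerSemicontinuous g)
    (hwell : ∀ ε > 0, ∃ r > ⨅ z, g z, ∀ y z, g y < r → g z < r → dist y z < ε) :
    ∃ u, argmin g = {u} := by
  set m := ⨅ z, g z
  obtain ⟨r₀, hr₀, -⟩ := hwell 1 one_pos
  have hbasis := (nhdsGE_basis_of_exists_gt ⟨r₀, hr₀⟩).comap g
  have hmin (y : X) : m ≤ g y := iInf_le g y
  have : NeBot (comap g (𝓝[≥] m)) := hbasis.neBot_iff.2 fun {r} hr =>
    (iInf_lt_iff.1 hr).imp fun y hy => ⟨hmin y, hy⟩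
  have hcauchy : Cauchy (comap g (𝓝[≥] m)) := Metric.cauchy_iff.2 ⟨this, fun ε hε =>
    let ⟨r, hr, hlt⟩ := hwell ε hε
    ⟨_, hbasis.mem_of_mem hr, fun y hy z hz => hlt y z hy.2 hz.2⟩⟩
  obtain ⟨u, hu⟩ := CompleteSpace.complete hcauchy
  have hum : g u ≤ m := by
    by_contra! hlt
    obtain ⟨r, hmr, hru⟩ := exists_between hlt
    have hev : ∀ᶠ y in 𝓝 u, r < g y := hg u r hru
    obtain ⟨y, hry, hyr⟩ := ((hev.filter_mono hu).and (hbasis.mem_of_mem hmr)).exists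
    exact lt_asymm hry hyr.2
  refine ⟨u, eq_singleton_iff_unique_mem.2 ⟨fun z => hum.trans (hmin z), fun y hy => ?_⟩⟩
  refine dist_le_zero.1 (le_of_forall_pos_le_add fun ε hε => ?_)
  obtain ⟨r, hr, hlt⟩ := hwell ε hε
  rw [zero_add]
  exact (hlt y u ((hy u).trans_lt (hum.trans_lt hr)) (hum.trans_lt hr)).le

end WellPosed

section Regularization

variable {G : Type*} [MetricSpace G] {p c K : ℝ} {f : G → EReal} {γ : ℝ → G} {x y z : G} {t : ℝ}

theorem IsGeodesic.dist_left (hγ : IsGeodesic γ x y) (ht : t ∈ Icc (0 : ℝ) 1) :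
    dist x (γ t) = t * dist x y := by
  have := hγ.2.2 0 ⟨le_rfl, zero_le_one⟩ t ht
  rwa [hγ.1, zero_sub, abs_neg, abs_of_nonneg ht.1] at this

theorem IsGeodesic.dist_right (hγ : IsGeodesic γ x y) (ht : t ∈ Icc (0 : ℝ) 1) :
    dist (γ t) y = (1 - t) * dist x y := by
  have := hγ.2.2 t ht 1 ⟨zero_le_one, le_rfl⟩
  rwa [hγ.2.1, abs_sub_comm, abs_of_nonneg (sub_nonneg.2 ht.2)] at this

theorem GeodesicallyConvex.le_coe (hconv : GeodesicallyConvex f) (hγ : IsGeodesic γ x y)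
    (ht : t ∈ Icc (0 : ℝ) 1) {a b : ℝ} (hx : f x ≤ a) (hy : f y ≤ b) :
    f (γ t) ≤ (((1 - t) * a + t * b : ℝ) : EReal) := by
  rw [EReal.coe_add, EReal.coe_mul, EReal.coe_mul]
  exact (hconv x y γ hγ t ht).trans <| add_le_add
    (mul_le_mul_of_nonneg_left hx (EReal.coe_nonneg.2 (sub_nonneg.2 ht.2)))
    (mul_le_mul_of_nonneg_left hy (EReal.coe_nonneg.2 ht.1))

theorem GeodesicallyConvex.exists_affine_le (hconv : GeodesicallyConvex f)
    (hgeo : ∀ y, ∃ γ : ℝ → G, IsGeodesic γ x y) (hlsc : LowerSemicontinuous f) {r : ℝ}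
    (hx : f x = r) :
    ∃ a b : ℝ, 0 ≤ b ∧ ∀ y, ((a - b * dist x y : ℝ) : EReal) ≤ f y := by
  have hlt : ((r - 1 : ℝ) : EReal) < f x := hx ▸ EReal.coe_lt_coe (sub_one_lt r)
  obtain ⟨ρ, hρ, hball⟩ := Metric.eventually_nhds_iff.1 (hlsc x _ hlt)
  refine ⟨r - 1, 2 / ρ, by positivity, fun y => ?_⟩
  rcases lt_or_ge (dist y x) ρ with hd | hd
  · refine le_trans (EReal.coe_le_coe ?_) (hball hd).le
    exact sub_le_self _ (by positivity)
  · by_contra! hy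
    obtain ⟨γ, hγ⟩ := hgeo y
    rw [dist_comm] at hd
    have hD : 0 < dist x y := hρ.trans_le hd
    -- the point of the geodesic at distance `ρ / 2` from `x`
    set t := ρ / (2 * dist x y) with ht
    have ht0 : 0 < t := by positivity
    have ht1 : t ∈ Icc (0 : ℝ) 1 := ⟨ht0.le, (div_le_one (by positivity)).2 (by linarith)⟩
    have htD : t * dist x y = ρ / 2 := by rw [ht]; field_simp
    have hlow : ((r - 1 : ℝ) : EReal) < f (γ t) :=
      hball (by rw [dist_comm, hγ.dist_left ht1, htD]; linarith)
    have hup := EReal.coe_lt_coe_iff.1 (hlow.trans_le (hconv.le_coe hγ ht1 hx.le hy.le))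
    have hslope : t * (2 / ρ * dist x y) = 1 := by rw [mul_left_comm, htD]; field_simp
    linarith

/-- The objective `y ↦ f y + K d(y, x)^p` that the proximal point of `x` minimizes; the parameter
`λ` of the proximal mapping enters through the weight `K = 1 / (p λ^(p-1))`. -/
noncomputable def regularized (p K : ℝ) (f : G → EReal) (x y : G) : EReal :=
  f y + ((K * dist y x ^ p : ℝ) : EReal)

theorem lowerSemicontinuous_regularized (hp : 0 ≤ p) (hlsc : LowerSemicontinuous f) (K : ℝ)
    (x : G) : LowerSemicontinuous (regularized p K f x) := by
  have hcont : Continuous fun y => ((K * dist y x ^ p : ℝ) : EReal) :=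
    continuous_coe_real_ereal.comp
      (continuous_const.mul ((continuous_id.dist continuous_const).rpow_const fun _ => .inr hp))
  exact hlsc.add' hcont.lowerSemicontinuous fun y =>
    EReal.continuousAt_add (.inr (EReal.coe_ne_bot _)) (.inr (EReal.coe_ne_top _))

theorem PUniformlyConvex.regularized_le (hG : PUniformlyConvex G p c)
    (hconv : GeodesicallyConvex f) (hK : 0 ≤ K) (hγ : IsGeodesic γ y z)
    (ht : t ∈ Icc (0 : ℝ) 1) {r s : ℝ} (hy : regularized p K f x y ≤ r)
    (hz : regularized p K f x z ≤ s) :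
    regularized p K f x (γ t) ≤
      (((1 - t) * r + t * s - K * (c / 2 * t * (1 - t) * dist y z ^ p) : ℝ) : EReal) := by
  refine add_coe_le_coe_iff.2 <| (hconv.le_coe hγ ht (add_coe_le_coe_iff.1 hy)
    (add_coe_le_coe_iff.1 hz)).trans (EReal.coe_le_coe ?_)
  have := mul_le_mul_of_nonneg_left (hG.2 y z x γ hγ t ht) hK
  rw [dist_comm x (γ t), dist_comm x y, dist_comm x z] at this
  linarith

theorem exists_le_regularized (hp : 1 < p) (hK : 0 < K) {a b : ℝ} (hb : 0 ≤ b)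
    (hf : ∀ y, ((a - b * dist z y : ℝ) : EReal) ≤ f y) (x : G) :
    ∃ B : ℝ, ∀ y, (B : EReal) ≤ regularized p K f x y := by
  obtain ⟨B, hB⟩ := exists_le_mul_rpow_sub_mul hp hK hb
  refine ⟨a - b * dist z x + B, fun y => le_trans ?_ (add_le_add_left (hf y) _)⟩
  rw [← EReal.coe_add, EReal.coe_le_coe_iff]
  have hpow := hB (dist y x) dist_nonneg
  have htri := mul_le_mul_of_nonneg_left (dist_triangle_right z y x) hb
  linarith

theorem PUniformlyConvex.exists_argmin_regularized_eq_singleton [CompleteSpace G]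
    (hG : PUniformlyConvex G p c) (hp : 1 < p) (hc : 0 < c) (hK : 0 < K) (hf : ProperFun f)
    (hconv : GeodesicallyConvex f) (hlsc : LowerSemicontinuous f) (x : G) :
    ∃ u, argmin (regularized p K f x) = {u} := by
  have hp0 : 0 < p := by linarith
  obtain ⟨hbot, z, hz⟩ := hf
  obtain ⟨a, b, hb, hab⟩ :=
    hconv.exists_affine_le (hG.1 z) hlsc (EReal.coe_toReal hz (hbot z)).symm
  obtain ⟨B, hB⟩ := exists_le_regularized hp hK hb hab x
  refine exists_argmin_eq_singleton (lowerSemicontinuous_regularized hp0.le hlsc K x)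
    fun ε hε => ?_
  have hbot' : ⨅ y, regularized p K f x y ≠ ⊥ :=
    ne_bot_of_le_ne_bot (EReal.coe_ne_bot B) (le_iInf hB)
  have htop' : ⨅ y, regularized p K f x y ≠ ⊤ :=
    ne_top_of_le_ne_top (EReal.add_ne_top hz (EReal.coe_ne_top _)) (iInf_le _ z)
  lift ⨅ y, regularized p K f x y to ℝ using ⟨htop', hbot'⟩ with m hm
  have hδ : 0 < K * (c / 16 * ε ^ p) := by positivity
  refine ⟨((m + K * (c / 16 * ε ^ p) : ℝ) : EReal),
    EReal.coe_lt_coe (lt_add_of_pos_right m hδ), fun y z hy hz => ?_⟩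
  obtain ⟨γ, hγ⟩ := hG.1 y z
  have hmid := EReal.coe_le_coe_iff.1 <| hm.trans_le (iInf_le _ _) |>.trans
    (hG.regularized_le hconv hK.le hγ (t := 1 / 2) (by norm_num) hy.le hz.le)
  by_contra! hle
  have hpow := mul_le_mul_of_nonneg_left (Real.rpow_le_rpow hε.le hle hp0.le) (mul_pos hK hc).le
  linarith

end Regularization

section ProximalPoint

variable {G : Type*} [MetricSpace G] {p K : ℝ} {f : G → EReal} {γ : ℝ → G} {u x y z : G}

theorem ne_top_of_mem_argmin_regularized (hf : ProperFun f)
    (hu : u ∈ argmin (regularized p K f x)) : f u ≠ ⊤ := by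
  obtain ⟨-, z, hz⟩ := hf
  intro htop
  have hle := hu z
  rw [regularized, htop, EReal.top_add_coe, top_le_iff] at hle
  exact EReal.add_ne_top hz (EReal.coe_ne_top _) hle

theorem dist_le_of_mem_argmin_regularized (hp : 0 < p) (hK : 0 < K) (hf : ProperFun f)
    (hu : u ∈ argmin (regularized p K f x)) (hz : f z ≤ f u) : dist u x ≤ dist z x := by
  have hle : f u + _ ≤ f u + _ := (hu z).trans (add_le_add_left hz _)
  lift f u to ℝ using ⟨ne_top_of_mem_argmin_regularized hf hu, hf.1 u⟩ with r
  rw [← EReal.coe_add, ← EReal.coe_add, EReal.coe_le_coe_iff, add_le_add_iff_left,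
    mul_le_mul_iff_right₀ hK] at hle
  exact (Real.rpow_le_rpow_iff dist_nonneg dist_nonneg hp).1 hle

theorem isMinOn_dist_of_mem_argmin_regularized (hp : 0 < p) (hK : 0 < K) (hf : ProperFun f)
    (hconv : GeodesicallyConvex f) (hu : u ∈ argmin (regularized p K f x)) (hy : y ∈ argmin f)
    (hγ : IsGeodesic γ u y) : IsMinOn (dist x) (γ '' Icc 0 1) u := by
  rintro _ ⟨t, ht, rfl⟩
  change dist x u ≤ dist x (γ t)
  rw [dist_comm x, dist_comm x]
  refine dist_le_of_mem_argmin_regularized hp hK hf hu ?_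
  have hyu := hy u
  have hfu := EReal.coe_toReal (ne_top_of_mem_argmin_regularized hf hu) (hf.1 u)
  refine (hconv.le_coe hγ ht hfu.ge (hyu.trans hfu.ge)).trans ?_
  rw [← add_mul, sub_add_cancel, one_mul, hfu]

theorem le_add_rpow_of_mem_argmin_regularized (hp : 1 < p) (hconv : GeodesicallyConvex f)
    (hy : y ∈ argmin (regularized p K f y)) {r s : ℝ}
    (hr : f y = r) (hs : f z ≤ s) (hγ : IsGeodesic γ y z) {t : ℝ} (ht : t ∈ Ioc (0 : ℝ) 1) :
    r ≤ s + K * (t ^ (p - 1) * dist y z ^ p) := by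
  have ht' : t ∈ Icc (0 : ℝ) 1 := Ioc_subset_Icc_self ht
  have hp0 : p ≠ 0 := by linarith
  have hself : regularized p K f y y = r := by
    rw [regularized, dist_self, Real.zero_rpow hp0, mul_zero, EReal.coe_zero, add_zero, hr]
  have hle := (hy (γ t)).trans (add_le_add_left (hconv.le_coe hγ ht' hr.le hs) _)
  rw [hself, ← EReal.coe_add, EReal.coe_le_coe_iff, dist_comm, hγ.dist_left ht',
    Real.mul_rpow ht.1.le dist_nonneg] at hle
  have hpow : t ^ p = t * t ^ (p - 1) := by
    rw [← Real.rpow_one_add' ht.1.le (by linarith), add_sub_cancel]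
  rw [hpow] at hle
  exact le_of_mul_le_mul_left (by linarith) ht.1

theorem mem_argmin_regularized_self_iff (hp : 1 < p) (hK : 0 ≤ K)
    (hgeo : ∀ x y : G, ∃ γ : ℝ → G, IsGeodesic γ x y) (hf : ProperFun f)
    (hconv : GeodesicallyConvex f) :
    y ∈ argmin (regularized p K f y) ↔ y ∈ argmin f := by
  have hp0 : p ≠ 0 := by linarith
  refine ⟨fun hy z => ?_, fun hy z => add_le_add (hy z) (EReal.coe_le_coe ?_)⟩
  · rcases eq_or_ne (f z) ⊤ with hz | hz
    · exact hz ▸ le_top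
    obtain ⟨γ, hγ⟩ := hgeo y z
    have hfy := EReal.coe_toReal (ne_top_of_mem_argmin_regularized hf hy) (hf.1 y)
    have hfz := EReal.coe_toReal hz (hf.1 z)
    have hcont : ContinuousAt
        (fun t : ℝ => (f y).toReal - K * (t ^ (p - 1) * dist y z ^ p)) 0 :=
      continuousAt_const.sub (continuousAt_const.mul
        ((Real.continuousAt_rpow_const 0 (p - 1) (.inr (by linarith))).mul continuousAt_const))
    have hlim := le_of_forall_Ioc_le hcont fun t ht => sub_le_iff_le_add.2
      (le_add_rpow_of_mem_argmin_regularized hp hconv hy hfy.symm hfz.ge hγ ht)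
    rw [Real.zero_rpow (by linarith), zero_mul, mul_zero, sub_zero] at hlim
    rw [← hfy, ← hfz]
    exact EReal.coe_le_coe hlim
  · rw [dist_self, Real.zero_rpow hp0, mul_zero]
    positivity

end ProximalPoint

section NearestPoint

variable {G : Type*} [MetricSpace G] {p c : ℝ} {γ η : ℝ → G} {u x y : G}

theorem IsGeodesic.left_mem (hγ : IsGeodesic γ x y) : x ∈ γ '' Icc 0 1 :=
  ⟨0, left_mem_Icc.2 zero_le_one, hγ.1⟩

theorem IsGeodesic.right_mem (hγ : IsGeodesic γ x y) : y ∈ γ '' Icc 0 1 :=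
  ⟨1, right_mem_Icc.2 zero_le_one, hγ.2.1⟩

theorem PUniformlyConvex.rpow_add_rpow_le_of_isMinOn (hG : PUniformlyConvex G p c) (hp : 0 ≤ p)
    (hγ : IsGeodesic γ u y) (hmin : IsMinOn (dist x) (γ '' Icc 0 1) u) :
    c / 2 * dist u y ^ p + dist x u ^ p ≤ dist x y ^ p := by
  refine add_le_of_forall_le_convexComb fun t ht => ?_
  have ht' : t ∈ Icc (0 : ℝ) 1 := Ioc_subset_Icc_self ht
  have hnear : dist x u ≤ dist x (γ t) := hmin (mem_image_of_mem γ ht')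
  linarith [Real.rpow_le_rpow dist_nonneg hnear hp, hG.2 u y x γ hγ t ht']

theorem IsGeodesic.perpAt_of_isMinOn (hη : IsGeodesic η u x) {S : Set G}
    (hmin : IsMinOn (dist x) S u) : PerpAt (η '' Icc 0 1) S u := by
  rintro _ ⟨s, hs, rfl⟩ y hy
  have hnear : dist x u ≤ dist x y := hmin hy
  rw [dist_comm (η s) u, hη.dist_left hs]
  linarith [dist_triangle_left x y (η s), hη.dist_right hs, dist_comm x u]

theorem SymmetricPerpendicular.isMinOn_dist (hsymm : SymmetricPerpendicular G)
    (hγ : IsGeodesic γ u y) (hη : IsGeodesic η u x) (hmin : IsMinOn (dist x) (γ '' Icc 0 1) u) :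
    IsMinOn (dist y) (η '' Icc 0 1) u :=
  (hsymm _ _ ⟨_, _, η, hη, rfl⟩ ⟨_, _, γ, hγ, rfl⟩ u ⟨hη.left_mem, hγ.left_mem⟩).1
    (hη.perpAt_of_isMinOn hmin) y hγ.right_mem

end NearestPoint

section ProximalMapping

variable {G : Type*} [MetricSpace G] {p c lam : ℝ} {f : G → EReal} {T : G → G} {γ : ℝ → G} {x y : G}

theorem exists_isProx [CompleteSpace G] (hp : 1 < p) (hc : 0 < c) (hlam : 0 < lam)
    (hG : PUniformlyConvex G p c) (hf : ProperFun f) (hconv : GeodesicallyConvex f)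
    (hlsc : LowerSemicontinuous f) : ∃ T : G → G, IsProx p lam f T := by
  have hK : 0 < 1 / (p * lam ^ (p - 1)) := by positivity
  choose T hT using
    hG.exists_argmin_regularized_eq_singleton hp hc hK hf hconv hlsc
  exact ⟨T, hT⟩

theorem IsProx.mem_argmin_iff (hT : IsProx p lam f T) :
    y ∈ argmin (regularized p (1 / (p * lam ^ (p - 1))) f x) ↔ y = T x :=
  Set.ext_iff.1 (hT x) y

theorem IsProx.argmin_eq_fixedPoints (hT : IsProx p lam f T) (hp : 1 < p) (hlam : 0 < lam)
    (hgeo : ∀ x y : G, ∃ γ : ℝ → G, IsGeodesic γ x y) (hf : ProperFun f)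
    (hconv : GeodesicallyConvex f) : argmin f = Function.fixedPoints T := by
  ext y
  rw [← mem_argmin_regularized_self_iff hp (K := 1 / (p * lam ^ (p - 1))) (by positivity) hgeo hf
    hconv, hT.mem_argmin_iff, Function.mem_fixedPoints_iff, eq_comm]

theorem IsProx.isMinOn_dist (hT : IsProx p lam f T) (hp : 0 < p) (hlam : 0 < lam)
    (hf : ProperFun f) (hconv : GeodesicallyConvex f) (hy : y ∈ argmin f)
    (hγ : IsGeodesic γ (T x) y) : IsMinOn (dist x) (γ '' Icc 0 1) (T x) :=
  isMinOn_dist_of_mem_argmin_regularized hp (by positivity) hf hconv (hT.mem_argmin_iff.2 rfl) hy hγ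

theorem IsProx.quasiStrictlyNonexpansive (hT : IsProx p lam f T) (hp : 1 < p) (hc : 0 < c)
    (hlam : 0 < lam) (hG : PUniformlyConvex G p c) (hf : ProperFun f)
    (hconv : GeodesicallyConvex f) (hsymm : SymmetricPerpendicular G) :
    QuasiStrictlyNonexpansive T := by
  intro x hx y hy
  have hp0 : 0 < p := by linarith
  rw [← hT.argmin_eq_fixedPoints hp hlam hG.1 hf hconv] at hy
  obtain ⟨γ, hγ⟩ := hG.1 (T x) y
  obtain ⟨η, hη⟩ := hG.1 (T x) x
  have hpyth := hG.rpow_add_rpow_le_of_isMinOn hp0.le hη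
    (hsymm.isMinOn_dist hγ hη (hT.isMinOn_dist hp0 hlam hf hconv hy hγ))
  have hpos : 0 < c / 2 * dist (T x) x ^ p :=
    mul_pos (half_pos hc) (Real.rpow_pos_of_pos (dist_pos.2 hx) p)
  rw [dist_comm y, dist_comm y] at hpyth
  exact (Real.rpow_lt_rpow_iff dist_nonneg dist_nonneg hp0).1
    ((lt_add_of_pos_left _ hpos).trans_le hpyth)

theorem transportDiscrepancy_of_fixed (hp : p ≠ 0) (a : ℝ) (hy : T y = y) :
    transportDiscrepancy p a T x y = a / 2 * dist (T x) x ^ p := by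
  rw [transportDiscrepancy, hy, dist_self, Real.zero_rpow hp]
  ring

theorem IsProx.almostFirmlyNonexpansiveAt (hT : IsProx p lam f T) (hp : 1 < p) (hc1 : 1 < c)
    (hc2 : c ≤ 2) (hlam : 0 < lam) (hG : PUniformlyConvex G p c) (hf : ProperFun f)
    (hconv : GeodesicallyConvex f) (hy : y ∈ argmin f) :
    AlmostFirmlyNonexpansiveAt p c (c * (c - 1) / (c * (c - 1) + 2)) ((2 - c) / (c - 1)) T
      univ y := by
  have hp0 : 0 < p := by linarith
  have hc0 : 0 < c := by linarith
  have hcp : 0 < c - 1 := by linarith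
  have hcc : 0 < c * (c - 1) := mul_pos hc0 hcp
  have hden : 0 < c * (c - 1) + 2 := by linarith
  refine ⟨⟨div_pos hcc hden, (div_lt_one hden).2 (by linarith)⟩,
    div_nonneg (by linarith) hcp.le, mem_univ y, fun x _ => ?_⟩
  have hTy : T y = y := (hT.argmin_eq_fixedPoints hp hlam hG.1 hf hconv).subset hy
  obtain ⟨γ, hγ⟩ := hG.1 (T x) y
  have hpyth := hG.rpow_add_rpow_le_of_isMinOn hp0.le hγ
    (hT.isMinOn_dist hp0 hlam hf hconv hy hγ)
  have hrhs : (1 + (2 - c) / (c - 1)) * dist x y ^ p -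
      (1 - c * (c - 1) / (c * (c - 1) + 2)) / (c * (c - 1) / (c * (c - 1) + 2)) *
        (c / 2 * dist (T x) x ^ p) = (dist x y ^ p - dist (T x) x ^ p) / (c - 1) := by
    field_simp
    ring
  rw [transportDiscrepancy_of_fixed hp0.ne' c hTy, hTy, hrhs, le_div_iff₀ hcp]
  have hcoef : (c - 1) * dist (T x) y ^ p ≤ c / 2 * dist (T x) y ^ p :=
    mul_le_mul_of_nonneg_right (by linarith) (by positivity)
  rw [dist_comm x (T x)] at hpyth
  linarith

end ProximalMapping

section ModulusOfConvexity

variable {G : Type*} [MetricSpace G] {p c : ℝ} {γ : ℝ → G} {x y : G}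

theorem IsGeodesic.comp_affine (hγ : IsGeodesic γ x y) {a b : ℝ} (ha : 0 ≤ a) (hab : a ≤ b)
    (hb : b ≤ 1) : IsGeodesic (fun t => γ (a + (b - a) * t)) (γ a) (γ b) := by
  have hmem : ∀ t ∈ Icc (0 : ℝ) 1, a + (b - a) * t ∈ Icc (0 : ℝ) 1 := fun t ht =>
    ⟨by nlinarith [ht.1], by nlinarith [ht.2]⟩
  refine ⟨by simp, by simp, fun s hs t ht => ?_⟩
  rw [hγ.2.2 _ (hmem s hs) _ (hmem t ht), hγ.2.2 a ⟨ha, hab.trans hb⟩ b ⟨ha.trans hab, hb⟩,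
    add_sub_add_left_eq_sub, ← mul_sub, abs_mul, abs_sub_comm b a]
  ring

theorem midpoint_rpow_sub_le {h : ℝ} (hp1 : 1 ≤ p) (hp2 : p ≤ 2) (hh : h ∈ Icc (0 : ℝ) 1) :
    (1 - h) ^ p / 2 + 1 / 2 - (1 - h / 2) ^ p ≤ (p - 1) / 2 * h ^ 2 := by
  have hlower : 1 + p * (-(h / 2)) ≤ (1 + -(h / 2)) ^ p :=
    one_add_mul_self_le_rpow_one_add (by linarith [hh.2]) hp1
  have hupper : (1 + -h) ^ (p - 1) ≤ 1 + (p - 1) * -h :=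
    rpow_one_add_le_one_add_mul_self (by linarith [hh.2]) (by linarith) (by linarith)
  have hfactor : (1 - h) ^ p = (1 - h) * (1 + -h) ^ (p - 1) := by
    rw [← sub_eq_add_neg, ← Real.rpow_one_add' (by linarith [hh.2]) (by linarith), add_sub_cancel]
  have hmul := mul_le_mul_of_nonneg_left hupper (sub_nonneg.2 hh.2)
  rw [← sub_eq_add_neg] at hlower
  rw [hfactor]
  linarith

theorem PUniformlyConvex.rpow_le_mul_sq [Nontrivial G] (hG : PUniformlyConvex G p c)
    (hp1 : 1 ≤ p) (hp2 : p ≤ 2) {h : ℝ} (hh : h ∈ Icc (0 : ℝ) 1) :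
    c / 8 * h ^ p ≤ (p - 1) / 2 * h ^ 2 := by
  obtain ⟨x, y, hxy⟩ := exists_pair_ne G
  have hD : 0 < dist x y := dist_pos.2 hxy
  obtain ⟨γ, hγ⟩ := hG.1 x y
  have hleft : 1 - h ∈ Icc (0 : ℝ) 1 := ⟨by linarith [hh.2], by linarith [hh.1]⟩
  have hmid : 1 - h / 2 ∈ Icc (0 : ℝ) 1 := ⟨by linarith [hh.2], by linarith [hh.1]⟩
  have hconv := hG.2 _ _ x _ (hγ.comp_affine hleft.1 hleft.2 le_rfl) (1 / 2) (by norm_num)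
  rw [show 1 - h + (1 - (1 - h)) * (1 / 2) = 1 - h / 2 by ring, hγ.dist_left hmid,
    hγ.dist_left hleft, hγ.2.1, hγ.dist_right hleft, sub_sub_cancel, Real.mul_rpow hmid.1 hD.le,
    Real.mul_rpow hleft.1 hD.le, Real.mul_rpow hh.1 hD.le] at hconv
  have hdiv : c / 8 * h ^ p ≤ (1 - h) ^ p / 2 + 1 / 2 - (1 - h / 2) ^ p :=
    le_of_mul_le_mul_right (by linarith) (Real.rpow_pos_of_pos hD p)
  exact hdiv.trans (midpoint_rpow_sub_le hp1 hp2 hh)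

theorem PUniformlyConvex.two_le [Nontrivial G] (hG : PUniformlyConvex G p c) (hp : 1 ≤ p)
    (hc : 0 < c) : 2 ≤ p := by
  by_contra! hp2
  have hcont : ContinuousAt (fun h : ℝ => c / 8 - (p - 1) / 2 * h ^ (2 - p)) 0 :=
    continuousAt_const.sub (continuousAt_const.mul
      (Real.continuousAt_rpow_const 0 (2 - p) (.inr (by linarith))))
  have hle : ∀ h ∈ Ioc (0 : ℝ) 1, c / 8 - (p - 1) / 2 * h ^ (2 - p) ≤ 0 := fun h hh => by
    have hsq : h ^ 2 = h ^ (2 - p) * h ^ p := by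
      rw [← Real.rpow_add hh.1, sub_add_cancel, Real.rpow_two]
    have hmain := hG.rpow_le_mul_sq hp hp2.le (Ioc_subset_Icc_self hh)
    rw [hsq, ← mul_assoc] at hmain
    exact sub_nonpos.2 (le_of_mul_le_mul_right hmain (Real.rpow_pos_of_pos hh.1 p))
  have hlim := le_of_forall_Ioc_le hcont hle
  rw [Real.zero_rpow (by linarith), mul_zero, sub_zero] at hlim
  linarith

end ModulusOfConvexity

section ModelPlane

/-- The geodesic segment from `u` to `y`, defined by the distance function `δ` alone so that it
makes sense in each of the model planes: the points that split `δ u y` in the ratio `s : 1 - s`. -/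
def metricSegment {M : Type*} (δ : M → M → ℝ) (u y : M) : Set M :=
  {a | ∃ s ∈ Icc (0 : ℝ) 1, δ u a = s * δ u y ∧ δ a y = (1 - s) * δ u y}

theorem right_mem_metricSegment {M : Type*} {δ : M → M → ℝ} (hself : ∀ v, δ v v = 0) (u y : M) :
    y ∈ metricSegment δ u y :=
  ⟨1, right_mem_Icc.2 zero_le_one, by rw [one_mul], by rw [hself, sub_self, zero_mul]⟩

theorem TriangleComparison.exists_isMinOn {G : Type*} [MetricSpace G] {κ k : ℝ} {M : Type}
    {δ : M → M → ℝ} (h : TriangleComparison G κ fun v w => δ v w / k) (hk : 0 < k)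
    (hself : ∀ v, δ v v = 0) (hsymm : ∀ v w, δ v w = δ w v) {u y x : G} {γ η : ℝ → G}
    (hγ : IsGeodesic γ u y) (hη : IsGeodesic η u x)
    (hper : 0 < κ → √κ * (dist u y + dist y x + dist x u) < 2 * Real.pi)
    (hmin : IsMinOn (dist x) (γ '' Icc 0 1) u) :
    ∃ u' y' x' : M, δ u' y' = k * dist u y ∧ δ x' y' = k * dist x y ∧ δ x' u' = k * dist x u ∧
      IsMinOn (δ x') (metricSegment δ u' y') u' := by
  obtain ⟨u', y', x', huy, hyx, hxu, hcomp⟩ := h u y x hper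
  beta_reduce at huy hyx hxu hcomp
  rw [div_eq_iff hk.ne', mul_comm] at huy hyx hxu
  refine ⟨u', y', x', huy, by rw [hsymm, hyx, dist_comm], hxu, ?_⟩
  rintro a ⟨s, hs, hua, hay⟩
  have hle := hcomp γ η hγ hη s hs 1 (right_mem_Icc.2 zero_le_one) a x'
    (by rw [hua, huy]; field_simp) (by rw [hay, huy]; field_simp)
    (by rw [hsymm, hxu, dist_comm]; field_simp) (by rw [hself]; ring)
  rw [hη.2.1, le_div_iff₀' hk, dist_comm] at hle
  change δ x' u' ≤ δ x' a
  rw [hxu, hsymm x']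
  exact (mul_le_mul_of_nonneg_left (hmin (mem_image_of_mem γ hs)) hk.le).trans hle

end ModelPlane

section Euclidean

variable {E : Type*} [NormedAddCommGroup E] [InnerProductSpace ℝ E] {u x y : E}

theorem lineMap_mem_metricSegment {s : ℝ} (hs : s ∈ Icc (0 : ℝ) 1) (u y : E) :
    AffineMap.lineMap u y s ∈ metricSegment dist u y :=
  ⟨s, hs, by rw [dist_left_lineMap, Real.norm_of_nonneg hs.1],
    by rw [dist_lineMap_right, Real.norm_of_nonneg (sub_nonneg.2 hs.2)]⟩

theorem dist_lineMap_sq (x u y : E) (s : ℝ) :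
    dist x (AffineMap.lineMap u y s) ^ 2 =
      (1 - s) * dist x u ^ 2 + s * dist x y ^ 2 - dist u y ^ 2 * s * (1 - s) := by
  have hx : x - AffineMap.lineMap u y s = (1 - s) • (x - u) + s • (x - y) := by
    rw [AffineMap.lineMap_apply_module]
    module
  have huy : dist u y = ‖(x - u) - (x - y)‖ := by
    rw [sub_sub_sub_cancel_left, dist_comm, dist_eq_norm]
  rw [huy, dist_eq_norm, dist_eq_norm, dist_eq_norm, hx, norm_add_sq_real,
    norm_sub_sq_real (x - u), norm_smul, norm_smul, mul_pow, mul_pow, Real.norm_eq_abs,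
    Real.norm_eq_abs, sq_abs, sq_abs, real_inner_smul_left, real_inner_smul_right]
  ring

theorem sq_add_sq_le_of_isMinOn (hmin : IsMinOn (dist x) (metricSegment dist u y) u) :
    dist u y ^ 2 + dist x u ^ 2 ≤ dist x y ^ 2 := by
  refine add_le_of_forall_le_convexComb fun s hs => ?_
  rw [← dist_lineMap_sq]
  exact pow_le_pow_left₀ dist_nonneg
    (hmin (lineMap_mem_metricSegment (Ioc_subset_Icc_self hs) u y)) 2

end Euclidean

section Sphere

open InnerProductGeometry Metric

variable {E : Type*} [NormedAddCommGroup E] [InnerProductSpace ℝ E]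

theorem cos_angle_eq_inner (v w : sphere (0 : E) 1) :
    Real.cos (angle (v : E) w) = inner ℝ (v : E) w :=
  (inner_eq_cos_angle_of_norm_eq_one (norm_eq_of_mem_sphere v) (norm_eq_of_mem_sphere w)).symm

theorem angle_eq_of_inner_eq_cos {v w : sphere (0 : E) 1} {θ : ℝ} (hθ : θ ∈ Icc 0 Real.pi)
    (h : inner ℝ (v : E) w = Real.cos θ) : angle (v : E) w = θ :=
  Real.injOn_cos ⟨angle_nonneg _ _, angle_le_pi _ _⟩ hθ (by rw [cos_angle_eq_inner, h])

theorem exists_unit_arc {u y : E} (hu : ‖u‖ = 1) (hy : ‖y‖ = 1) {A B : ℝ}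
    (huy : inner ℝ u y = Real.cos (A + B)) (hsin : Real.sin (A + B) ≠ 0) :
    ∃ a : E, ‖a‖ = 1 ∧ inner ℝ u a = Real.cos B ∧ inner ℝ a y = Real.cos A ∧
      ∀ x : E, Real.sin (A + B) * inner ℝ a x =
        Real.sin A * inner ℝ u x + Real.sin B * inner ℝ y x := by
  have huu : inner ℝ u u = (1 : ℝ) := inner_self_eq_one_of_norm_eq_one hu
  have hyy : inner ℝ y y = (1 : ℝ) := inner_self_eq_one_of_norm_eq_one hy
  set a : E := (Real.sin (A + B))⁻¹ • (Real.sin A • u + Real.sin B • y) with ha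
  have hax (x : E) : Real.sin (A + B) * inner ℝ a x =
      Real.sin A * inner ℝ u x + Real.sin B * inner ℝ y x := by
    rw [ha, real_inner_smul_left, inner_add_left, real_inner_smul_left, real_inner_smul_left,
      mul_inv_cancel_left₀ hsin]
  have hau : inner ℝ a u = Real.cos B := by
    refine mul_left_cancel₀ hsin ?_
    rw [hax, huu, real_inner_comm, huy, Real.sin_add, Real.cos_add]
    linear_combination -Real.sin A * Real.sin_sq_add_cos_sq B
  have hay : inner ℝ a y = Real.cos A := by
    refine mul_left_cancel₀ hsin ?_
    rw [hax, hyy, huy, Real.sin_add, Real.cos_add]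
    linear_combination -Real.sin B * Real.sin_sq_add_cos_sq A
  have haa : inner ℝ a a = (1 : ℝ) := by
    refine mul_left_cancel₀ hsin ?_
    rw [hax, real_inner_comm, hau, real_inner_comm, hay, Real.sin_add]
    ring
  have hnorm : ‖a‖ = 1 := by
    rw [norm_eq_sqrt_real_inner, haa, Real.sqrt_one]
  exact ⟨a, hnorm, by rw [real_inner_comm, hau], hay, hax⟩

theorem exists_mem_metricSegment_angle {u y : sphere (0 : E) 1}
    (hsin : Real.sin (angle (u : E) y) ≠ 0) {s : ℝ} (hs : s ∈ Icc (0 : ℝ) 1) :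
    ∃ a ∈ metricSegment (fun v w : sphere (0 : E) 1 => angle (v : E) w) u y,
      ∀ x : sphere (0 : E) 1, Real.sin (angle (u : E) y) * Real.cos (angle (x : E) a) =
        Real.sin ((1 - s) * angle (u : E) y) * Real.cos (angle (x : E) u) +
          Real.sin (s * angle (u : E) y) * Real.cos (angle (x : E) y) := by
  have hmem : angle (u : E) y ∈ Icc 0 Real.pi := ⟨angle_nonneg _ _, angle_le_pi _ _⟩
  have hsum : (1 - s) * angle (u : E) y + s * angle (u : E) y = angle (u : E) y := by ring
  have hscale {r : ℝ} (hr : r ∈ Icc (0 : ℝ) 1) : r * angle (u : E) y ∈ Icc 0 Real.pi :=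
    ⟨mul_nonneg hr.1 hmem.1, (mul_le_of_le_one_left hmem.1 hr.2).trans hmem.2⟩
  obtain ⟨a, ha, hua, hay, hax⟩ := exists_unit_arc (norm_eq_of_mem_sphere u)
    (norm_eq_of_mem_sphere y) (hsum ▸ (cos_angle_eq_inner u y).symm) (hsum.symm ▸ hsin)
  lift a to sphere (0 : E) 1 using mem_sphere_zero_iff_norm.2 ha
  refine ⟨a, ⟨s, hs, angle_eq_of_inner_eq_cos (hscale hs) hua, angle_eq_of_inner_eq_cos
    (hscale ⟨sub_nonneg.2 hs.2, sub_le_self 1 hs.1⟩) hay⟩, fun x => ?_⟩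
  simp only [angle_comm (x : E), cos_angle_eq_inner, ← hax, hsum]

theorem le_cos_mul_of_forall_Ioc {θ α β : ℝ} (hθ : θ ∈ Ioo 0 Real.pi)
    (h : ∀ s ∈ Ioc (0 : ℝ) 1,
      Real.sin ((1 - s) * θ) * α + Real.sin (s * θ) * β ≤ Real.sin θ * α) :
    β ≤ Real.cos θ * α := by
  have hcont : ContinuousAt
      (fun s => Real.cos (s * θ / 2) * β - Real.cos (θ - s * θ / 2) * α) 0 := by fun_prop
  have hle : ∀ s ∈ Ioc (0 : ℝ) 1,
      Real.cos (s * θ / 2) * β - Real.cos (θ - s * θ / 2) * α ≤ 0 := fun s hs => by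
    have hpos : 0 < Real.sin (s * θ / 2) :=
      Real.sin_pos_of_pos_of_lt_pi (by have := mul_pos hs.1 hθ.1; positivity)
        (by nlinarith [hs.2, hθ.1, hθ.2])
    have hdiff : Real.sin θ - Real.sin ((1 - s) * θ) =
        2 * Real.sin (s * θ / 2) * Real.cos (θ - s * θ / 2) := by
      rw [Real.sin_sub_sin]; ring_nf
    have hdouble : Real.sin (s * θ) = 2 * Real.sin (s * θ / 2) * Real.cos (s * θ / 2) := by
      rw [← Real.sin_two_mul]; ring_nf
    have hle := h s hs
    rw [hdouble] at hle
    refine le_of_mul_le_mul_left (a := 2 * Real.sin (s * θ / 2)) ?_ (by positivity)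
    linear_combination hle + α * hdiff
  simpa using le_of_forall_Ioc_le hcont hle

theorem cos_le_cos_mul_cos_of_isMinOn {u x y : sphere (0 : E) 1} (hπ : angle (u : E) y < Real.pi)
    (hmin : IsMinOn (fun v : sphere (0 : E) 1 => angle (x : E) v)
      (metricSegment (fun v w : sphere (0 : E) 1 => angle (v : E) w) u y) u) :
    Real.cos (angle (x : E) y) ≤ Real.cos (angle (u : E) y) * Real.cos (angle (x : E) u) := by
  have hcos {a} (ha : a ∈ metricSegment (fun v w : sphere (0 : E) 1 => angle (v : E) w) u y) :
      Real.cos (angle (x : E) a) ≤ Real.cos (angle (x : E) u) :=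
    Real.cos_le_cos_of_nonneg_of_le_pi (angle_nonneg _ _) (angle_le_pi _ _) (hmin ha)
  rcases (angle_nonneg (u : E) y).eq_or_lt with h0 | h0
  · rw [← h0, Real.cos_zero, one_mul]
    have hself (v : sphere (0 : E) 1) : angle (v : E) v = 0 :=
      angle_self (ne_of_mem_sphere v.2 one_ne_zero)
    exact hcos (right_mem_metricSegment hself u y)
  have hsin := Real.sin_pos_of_pos_of_lt_pi h0 hπ
  refine le_cos_mul_of_forall_Ioc ⟨h0, hπ⟩ fun s hs => ?_
  obtain ⟨a, ha, hax⟩ := exists_mem_metricSegment_angle hsin.ne' (Ioc_subset_Icc_self hs)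
  rw [← hax]
  exact mul_le_mul_of_nonneg_left (hcos ha) hsin.le

end Sphere

section Hyperbolic

open UpperHalfPlane

/-- The bilinear form of signature `(1, 2)` on `ℝ³` whose unit vectors with positive first
coordinate form the hyperboloid model of the hyperbolic plane. In these null coordinates it is
the polarization of `v ↦ v₀ v₂ - v₁ ^ 2`. -/
noncomputable def lorentzForm : LinearMap.BilinForm ℝ (Fin 3 → ℝ) :=
  LinearMap.mk₂ ℝ (fun v w => (v 0 * w 2 + v 2 * w 0) / 2 - v 1 * w 1)
    (fun _ _ _ => by simp only [Pi.add_apply]; ring)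
    (fun _ _ _ => by simp only [Pi.smul_apply, smul_eq_mul]; ring)
    (fun _ _ _ => by simp only [Pi.add_apply]; ring)
    (fun _ _ _ => by simp only [Pi.smul_apply, smul_eq_mul]; ring)

/-- The isometry from the upper half-plane to the hyperboloid of `lorentzForm`. -/
noncomputable def hyperboloidPoint (z : ℍ) : Fin 3 → ℝ :=
  ![1 / z.im, z.re / z.im, (z.re ^ 2 + z.im ^ 2) / z.im]

theorem lorentzForm_comm (v w : Fin 3 → ℝ) : lorentzForm v w = lorentzForm w v := by
  simp only [lorentzForm, LinearMap.mk₂_apply]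
  ring

theorem lorentzForm_hyperboloidPoint (z w : ℍ) :
    lorentzForm (hyperboloidPoint z) (hyperboloidPoint w) = Real.cosh (dist z w) := by
  have hz := z.im_pos.ne'
  have hw := w.im_pos.ne'
  simp only [lorentzForm, LinearMap.mk₂_apply, hyperboloidPoint, Matrix.cons_val, cosh_dist']
  field_simp
  ring

theorem exists_hyperboloidPoint_eq {v : Fin 3 → ℝ} (hv0 : 0 < v 0) (hv : lorentzForm v v = 1) :
    ∃ z : ℍ, hyperboloidPoint z = v := by
  refine ⟨⟨⟨v 1 / v 0, 1 / v 0⟩, one_div_pos.2 hv0⟩, ?_⟩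
  simp only [lorentzForm, LinearMap.mk₂_apply] at hv
  ext i
  fin_cases i
  · exact one_div_one_div (v 0)
  · change v 1 / v 0 / (1 / v 0) = v 1
    field_simp
  · change ((v 1 / v 0) ^ 2 + (1 / v 0) ^ 2) / (1 / v 0) = v 2
    field_simp
    linarith

theorem lorentzForm_hyperboloidPoint_self (z : ℍ) :
    lorentzForm (hyperboloidPoint z) (hyperboloidPoint z) = 1 := by
  rw [lorentzForm_hyperboloidPoint, dist_self, Real.cosh_zero]

theorem sinh_mul_add_sinh_mul_pos {A B α β : ℝ} (hA : 0 ≤ A) (hB : 0 ≤ B) (hpos : 0 < A + B)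
    (hα : 0 < α) (hβ : 0 < β) : 0 < Real.sinh A * α + Real.sinh B * β := by
  rcases hA.eq_or_lt with rfl | hA
  · rw [zero_add] at hpos
    rw [Real.sinh_zero, zero_mul, zero_add]
    exact mul_pos (Real.sinh_pos_iff.2 hpos) hβ
  · exact add_pos_of_pos_of_nonneg (mul_pos (Real.sinh_pos_iff.2 hA) hα)
      (mul_nonneg (Real.sinh_nonneg_iff.2 hB) hβ.le)

theorem exists_hyperboloid_arc {u y : Fin 3 → ℝ} (hu0 : 0 < u 0) (hy0 : 0 < y 0)
    (huu : lorentzForm u u = 1) (hyy : lorentzForm y y = 1) {A B : ℝ} (hA : 0 ≤ A) (hB : 0 ≤ B)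
    (hpos : 0 < A + B) (huy : lorentzForm u y = Real.cosh (A + B)) :
    ∃ a : Fin 3 → ℝ, 0 < a 0 ∧ lorentzForm a a = 1 ∧ lorentzForm u a = Real.cosh B ∧
      lorentzForm a y = Real.cosh A ∧ ∀ x : Fin 3 → ℝ, Real.sinh (A + B) * lorentzForm a x =
        Real.sinh A * lorentzForm u x + Real.sinh B * lorentzForm y x := by
  have hsinh : 0 < Real.sinh (A + B) := Real.sinh_pos_iff.2 hpos
  set a : Fin 3 → ℝ := (Real.sinh (A + B))⁻¹ • (Real.sinh A • u + Real.sinh B • y) with ha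
  have hax (x : Fin 3 → ℝ) : Real.sinh (A + B) * lorentzForm a x =
      Real.sinh A * lorentzForm u x + Real.sinh B * lorentzForm y x := by
    simp only [ha, map_smul, map_add, LinearMap.smul_apply, LinearMap.add_apply, smul_eq_mul,
      mul_inv_cancel_left₀ hsinh.ne']
  have hau : lorentzForm a u = Real.cosh B := by
    refine mul_left_cancel₀ hsinh.ne' ?_
    rw [hax, huu, lorentzForm_comm y, huy, Real.sinh_add, Real.cosh_add]
    linear_combination -Real.sinh A * Real.cosh_sq B
  have hay : lorentzForm a y = Real.cosh A := by
    refine mul_left_cancel₀ hsinh.ne' ?_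
    rw [hax, hyy, huy, Real.sinh_add, Real.cosh_add]
    linear_combination -Real.sinh B * Real.cosh_sq A
  have haa : lorentzForm a a = 1 := by
    refine mul_left_cancel₀ hsinh.ne' ?_
    rw [hax, lorentzForm_comm u, hau, lorentzForm_comm y, hay, Real.sinh_add]
    ring
  exact ⟨a, mul_pos (inv_pos.2 hsinh) (sinh_mul_add_sinh_mul_pos hA hB hpos hu0 hy0), haa,
    by rw [lorentzForm_comm, hau], hay, hax⟩

theorem exists_mem_metricSegment_dist {u y : ℍ} (huy : 0 < dist u y) {s : ℝ}
    (hs : s ∈ Icc (0 : ℝ) 1) :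
    ∃ a ∈ metricSegment dist u y, ∀ x : ℍ, Real.sinh (dist u y) * Real.cosh (dist x a) =
      Real.sinh ((1 - s) * dist u y) * Real.cosh (dist x u) +
        Real.sinh (s * dist u y) * Real.cosh (dist x y) := by
  have hsum : (1 - s) * dist u y + s * dist u y = dist u y := by ring
  have hA : 0 ≤ (1 - s) * dist u y := mul_nonneg (sub_nonneg.2 hs.2) huy.le
  have hB : 0 ≤ s * dist u y := mul_nonneg hs.1 huy.le
  obtain ⟨v, hv0, hvv, huv, hvy, hvx⟩ := exists_hyperboloid_arc (one_div_pos.2 u.im_pos)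
    (one_div_pos.2 y.im_pos) (lorentzForm_hyperboloidPoint_self u)
    (lorentzForm_hyperboloidPoint_self y) hA hB (hsum.symm ▸ huy)
    (hsum.symm ▸ lorentzForm_hyperboloidPoint u y)
  obtain ⟨a, rfl⟩ := exists_hyperboloidPoint_eq hv0 hvv
  rw [lorentzForm_hyperboloidPoint] at huv hvy
  refine ⟨a, ⟨s, hs, Real.cosh_strictMonoOn.injOn dist_nonneg hB huv,
    Real.cosh_strictMonoOn.injOn dist_nonneg hA hvy⟩, fun x => ?_⟩
  simpa only [lorentzForm_hyperboloidPoint, hsum, dist_comm _ x] using hvx (hyperboloidPoint x)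

theorem cosh_mul_le_of_forall_Ioc {θ α β : ℝ} (hθ : 0 < θ)
    (h : ∀ s ∈ Ioc (0 : ℝ) 1,
      Real.sinh θ * α ≤ Real.sinh ((1 - s) * θ) * α + Real.sinh (s * θ) * β) :
    Real.cosh θ * α ≤ β := by
  have hcont : ContinuousAt
      (fun s => Real.cosh (θ - s * θ / 2) * α - Real.cosh (s * θ / 2) * β) 0 := by fun_prop
  have hle : ∀ s ∈ Ioc (0 : ℝ) 1,
      Real.cosh (θ - s * θ / 2) * α - Real.cosh (s * θ / 2) * β ≤ 0 := fun s hs => by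
    have hpos : 0 < Real.sinh (s * θ / 2) :=
      Real.sinh_pos_iff.2 (by have := mul_pos hs.1 hθ; positivity)
    have hdiff : Real.sinh θ - Real.sinh ((1 - s) * θ) =
        2 * Real.sinh (s * θ / 2) * Real.cosh (θ - s * θ / 2) := by
      have hadd := Real.sinh_add (θ - s * θ / 2) (s * θ / 2)
      have hsub := Real.sinh_sub (θ - s * θ / 2) (s * θ / 2)
      rw [sub_add_cancel] at hadd
      rw [show θ - s * θ / 2 - s * θ / 2 = (1 - s) * θ by ring] at hsub
      rw [hadd, hsub]
      ring
    have hdouble : Real.sinh (s * θ) = 2 * Real.sinh (s * θ / 2) * Real.cosh (s * θ / 2) := by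
      rw [← Real.sinh_two_mul]; ring_nf
    have hle := h s hs
    rw [hdouble] at hle
    refine le_of_mul_le_mul_left (a := 2 * Real.sinh (s * θ / 2)) ?_ (by positivity)
    linear_combination hle - α * hdiff
  simpa using le_of_forall_Ioc_le hcont hle

theorem cosh_mul_cosh_le_of_isMinOn {u x y : ℍ}
    (hmin : IsMinOn (dist x) (metricSegment dist u y) u) :
    Real.cosh (dist u y) * Real.cosh (dist x u) ≤ Real.cosh (dist x y) := by
  have hcosh {a} (ha : a ∈ metricSegment dist u y) :
      Real.cosh (dist x u) ≤ Real.cosh (dist x a) :=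
    Real.cosh_strictMonoOn.monotoneOn dist_nonneg dist_nonneg (hmin ha)
  rcases (dist_nonneg (x := u) (y := y)).eq_or_lt with h0 | h0
  · rw [← h0, Real.cosh_zero, one_mul]
    exact hcosh (right_mem_metricSegment dist_self u y)
  refine cosh_mul_le_of_forall_Ioc h0 fun s hs => ?_
  obtain ⟨a, ha, hax⟩ := exists_mem_metricSegment_dist h0 (Ioc_subset_Icc_self hs)
  rw [← hax]
  exact mul_le_mul_of_nonneg_left (hcosh ha) (Real.sinh_nonneg_iff.2 h0.le)

end Hyperbolic

section Comparison

variable {G : Type*} [MetricSpace G] {κ : ℝ} {u x y : G} {γ η : ℝ → G}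

theorem TriangleComparison.sq_add_sq_le {E : Type} [NormedAddCommGroup E] [InnerProductSpace ℝ E]
    (hκ : κ ≤ 0) (h : TriangleComparison G κ fun v w : E => dist v w) (hγ : IsGeodesic γ u y)
    (hη : IsGeodesic η u x) (hmin : IsMinOn (dist x) (γ '' Icc 0 1) u) :
    dist u y ^ 2 + dist x u ^ 2 ≤ dist x y ^ 2 := by
  have h1 : TriangleComparison G κ fun v w : E => dist v w / 1 := by simpa only [div_one] using h
  obtain ⟨u', y', x', huy, hxy, hxu, hmin'⟩ := h1.exists_isMinOn one_pos dist_self dist_comm hγ hη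
    (fun hpos => absurd hpos hκ.not_gt) hmin
  simpa only [huy, hxy, hxu, one_mul] using sq_add_sq_le_of_isMinOn hmin'

theorem TriangleComparison.cosh_mul_cosh_le (hκ : κ < 0)
    (h : TriangleComparison G κ (hyperbolicDist κ)) (hγ : IsGeodesic γ u y)
    (hη : IsGeodesic η u x) (hmin : IsMinOn (dist x) (γ '' Icc 0 1) u) :
    Real.cosh (√(-κ) * dist u y) * Real.cosh (√(-κ) * dist x u) ≤
      Real.cosh (√(-κ) * dist x y) := by
  obtain ⟨u', y', x', huy, hxy, hxu, hmin'⟩ := TriangleComparison.exists_isMinOn (δ := dist) h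
    (Real.sqrt_pos.2 (neg_pos.2 hκ)) dist_self dist_comm hγ hη
    (fun hpos => absurd hpos hκ.not_gt) hmin
  simpa only [huy, hxy, hxu] using cosh_mul_cosh_le_of_isMinOn hmin'

theorem TriangleComparison.cos_le_cos_mul_cos (hκ : 0 < κ)
    (h : TriangleComparison G κ (sphereDist κ)) (hγ : IsGeodesic γ u y) (hη : IsGeodesic η u x)
    (hper : √κ * (dist u y + dist y x + dist x u) < 2 * Real.pi)
    (hmin : IsMinOn (dist x) (γ '' Icc 0 1) u) :
    Real.cos (√κ * dist x y) ≤ Real.cos (√κ * dist u y) * Real.cos (√κ * dist x u) := by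
  have hk : 0 < √κ := Real.sqrt_pos.2 hκ
  obtain ⟨u', y', x', huy, hxy, hxu, hmin'⟩ := TriangleComparison.exists_isMinOn
    (δ := fun v w : Metric.sphere (0 : EuclideanSpace ℝ (Fin 3)) 1 =>
      InnerProductGeometry.angle (v : EuclideanSpace ℝ (Fin 3)) w) h hk
    (fun v => InnerProductGeometry.angle_self (Metric.ne_of_mem_sphere v.2 one_ne_zero))
    (fun v w => InnerProductGeometry.angle_comm _ _) hγ hη (fun _ => hper) hmin
  have hπ : √κ * dist u y < Real.pi := by
    have htri := mul_le_mul_of_nonneg_left (dist_triangle_right u y x) hk.le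
    rw [dist_comm u x] at htri
    linarith
  simpa only [huy, hxy, hxu] using cos_le_cos_mul_cos_of_isMinOn (huy.trans_lt hπ) hmin'

end Comparison

section InfinitesimalPythagoras

theorem sq_add_sq_le_of_cos_le {a b c : ℝ} (ha : 0 ≤ a) (hb : 0 ≤ b) (hac : a ≤ 2 * c)
    (hbc : b ≤ c) (hc : 3 * c ≤ 1) (h : Real.cos c ≤ Real.cos a * Real.cos b) :
    a ^ 2 + b ^ 2 ≤ c ^ 2 + 10 * c ^ 4 := by
  have hbound {t : ℝ} (ht : |t| ≤ 3 * c) : Real.cos t ≤ 1 - t ^ 2 / 2 + 5 * c ^ 4 := by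
    have hcos := (abs_le.1 (Real.cos_bound (ht.trans hc))).2
    have ht4 : |t| ^ 4 ≤ (3 * c) ^ 4 := pow_le_pow_left₀ (abs_nonneg t) ht 4
    have hc4 : 0 ≤ c ^ 4 := by positivity
    linarith
  have hadd := hbound (t := a + b) (abs_le.2 ⟨by linarith, by linarith⟩)
  have hsub := hbound (t := a - b) (abs_le.2 ⟨by linarith, by linarith⟩)
  rw [Real.cos_add] at hadd
  rw [Real.cos_sub] at hsub
  linarith [Real.one_sub_sq_div_two_le_cos (x := c)]

theorem one_add_sq_half_le_cosh (x : ℝ) : 1 + x ^ 2 / 2 ≤ Real.cosh x := by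
  have hcosh : Real.cosh x = 1 + 2 * Real.sinh (x / 2) ^ 2 := by
    have hdouble := Real.cosh_two_mul (x / 2)
    rw [mul_div_cancel₀ x two_ne_zero, Real.cosh_sq] at hdouble
    linarith
  have hsinh : (x / 2) ^ 2 ≤ Real.sinh (x / 2) ^ 2 := by
    rw [sq_le_sq, Real.abs_sinh]
    exact Real.self_le_sinh_iff.2 (abs_nonneg _)
  linarith

theorem sq_add_sq_le_of_cosh_le {a b c : ℝ} (hc : |c| ≤ 1)
    (h : Real.cosh a * Real.cosh b ≤ Real.cosh c) : a ^ 2 + b ^ 2 ≤ c ^ 2 + 10 * c ^ 4 := by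
  have hab := mul_le_mul (one_add_sq_half_le_cosh a) (one_add_sq_half_le_cosh b) (by positivity)
    (by positivity)
  have hc2 : |c ^ 2 / 2| ≤ 1 := by
    rw [abs_of_nonneg (by positivity)]
    linarith [(sq_le_one_iff_abs_le_one c).2 hc]
  have hexp := (abs_le.1 (Real.abs_exp_sub_one_sub_id_le hc2)).2
  have ha2b2 : 0 ≤ a ^ 2 * b ^ 2 := by positivity
  have hc4 : 0 ≤ c ^ 4 := by positivity
  linarith [Real.cosh_le_exp_half_sq c]

theorem sq_add_sq_le_of_scaled {k a b c : ℝ} (hk : 0 < k)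
    (h : (√k * a) ^ 2 + (√k * b) ^ 2 ≤ (√k * c) ^ 2 + 10 * (√k * c) ^ 4) :
    a ^ 2 + b ^ 2 ≤ (1 + 10 * k * c ^ 2) * c ^ 2 := by
  have hsq : √k ^ 2 = k := Real.sq_sqrt hk.le
  have hpow : √k ^ 4 = k ^ 2 := by rw [show √k ^ 4 = (√k ^ 2) ^ 2 by ring, hsq]
  rw [mul_pow, mul_pow, mul_pow, mul_pow, hsq, hpow] at h
  refine le_of_mul_le_mul_left ?_ hk
  linarith

theorem IsCAT.sq_add_sq_le {G : Type*} [MetricSpace G] {κ : ℝ} (h : IsCAT G κ) {u x y : G}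
    {γ η : ℝ → G} (hγ : IsGeodesic γ u y) (hη : IsGeodesic η u x)
    (hmin : IsMinOn (dist x) (γ '' Icc 0 1) u) (hsmall : 3 * (√|κ| * dist x y) ≤ 1) :
    dist u y ^ 2 + dist x u ^ 2 ≤ (1 + 10 * |κ| * dist x y ^ 2) * dist x y ^ 2 := by
  obtain ⟨-, hsphere, hplane, hhyp⟩ := h
  rcases lt_trichotomy κ 0 with hκ | rfl | hκ
  · rw [abs_of_neg hκ] at hsmall ⊢
    have hdist : |√(-κ) * dist x y| ≤ 1 := by
      rw [abs_of_nonneg (by positivity)]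
      linarith [show 0 ≤ √(-κ) * dist x y by positivity]
    exact sq_add_sq_le_of_scaled (neg_pos.2 hκ)
      (sq_add_sq_le_of_cosh_le hdist ((hhyp hκ).cosh_mul_cosh_le hκ hγ hη hmin))
  · simpa using (hplane rfl).sq_add_sq_le le_rfl hγ hη hmin
  · rw [abs_of_pos hκ] at hsmall ⊢
    have hxu : √κ * dist x u ≤ √κ * dist x y :=
      mul_le_mul_of_nonneg_left (hmin hγ.right_mem) (Real.sqrt_nonneg κ)
    have huy : √κ * dist u y ≤ 2 * (√κ * dist x y) := by
      have htri := mul_le_mul_of_nonneg_left (dist_triangle_left u y x) (Real.sqrt_nonneg κ)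
      linarith
    have hper : √κ * (dist u y + dist y x + dist x u) < 2 * Real.pi := by
      rw [dist_comm y x]
      linarith [Real.pi_gt_three]
    exact sq_add_sq_le_of_scaled hκ (sq_add_sq_le_of_cos_le (by positivity) (by positivity) huy hxu
      hsmall ((hsphere hκ).cos_le_cos_mul_cos hκ hγ hη hper hmin))

theorem rpow_add_rpow_le_of_sq_add_sq_le {p : ℝ} (hp : 2 ≤ p) {a b d K : ℝ} (ha : 0 ≤ a)
    (hb : 0 ≤ b) (hd : 0 ≤ d) (hK : 0 ≤ K) (h : a ^ 2 + b ^ 2 ≤ K * d ^ 2) :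
    a ^ p + b ^ p ≤ K ^ (p / 2) * d ^ p := by
  have hsq {r : ℝ} (hr : 0 ≤ r) : (r ^ 2) ^ (p / 2) = r ^ p := by
    rw [← Real.rpow_natCast_mul hr, Nat.cast_ofNat, mul_div_cancel₀ p two_ne_zero]
  calc a ^ p + b ^ p = (a ^ 2) ^ (p / 2) + (b ^ 2) ^ (p / 2) := by rw [hsq ha, hsq hb]
    _ ≤ (a ^ 2 + b ^ 2) ^ (p / 2) :=
      Real.add_rpow_le_rpow_add (sq_nonneg a) (sq_nonneg b) (by linarith)
    _ ≤ (K * d ^ 2) ^ (p / 2) := Real.rpow_le_rpow (by positivity) h (by linarith)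
    _ = K ^ (p / 2) * d ^ p := by rw [Real.mul_rpow hK (by positivity), hsq hd]

end InfinitesimalPythagoras

section AsymptoticFirmness

variable {G : Type*} [MetricSpace G] {p c lam κ : ℝ} {f : G → EReal} {T : G → G} {y : G}

theorem IsProx.eventually_rpow_add_rpow_le (hT : IsProx p lam f T) (hp : 2 ≤ p) (hlam : 0 < lam)
    (hgeo : ∀ x y : G, ∃ γ : ℝ → G, IsGeodesic γ x y) (hf : ProperFun f)
    (hconv : GeodesicallyConvex f) (hκ : IsCAT G κ) (hy : y ∈ argmin f) {ε : ℝ} (hε : 0 < ε) :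
    ∀ᶠ x in 𝓝 y, dist (T x) y ^ p + dist x (T x) ^ p ≤ (1 + ε) * dist x y ^ p := by
  have hfactor : ∀ᶠ x in 𝓝 y, (1 + 10 * |κ| * dist x y ^ 2) ^ (p / 2) < 1 + ε := by
    have hcont : ContinuousAt (fun x => (1 + 10 * |κ| * dist x y ^ 2) ^ (p / 2)) y :=
      ContinuousAt.rpow_const (by fun_prop) (.inr (by linarith))
    exact hcont.eventually_lt_const (by simpa using hε)
  have hsmall : ∀ᶠ x in 𝓝 y, 3 * (√|κ| * dist x y) < 1 := by
    have hcont : ContinuousAt (fun x => 3 * (√|κ| * dist x y)) y := by fun_prop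
    exact hcont.eventually_lt_const (by simp)
  filter_upwards [hfactor, hsmall] with x hxε hx
  obtain ⟨γ, hγ⟩ := hgeo (T x) y
  obtain ⟨η, hη⟩ := hgeo (T x) x
  have hpyth := hκ.sq_add_sq_le hγ hη
    (hT.isMinOn_dist (by linarith) hlam hf hconv hy hγ) hx.le
  exact (rpow_add_rpow_le_of_sq_add_sq_le hp dist_nonneg dist_nonneg dist_nonneg (by positivity)
    hpyth).trans (mul_le_mul_of_nonneg_right hxε.le (by positivity))

theorem asymptoticallyFirmlyNonexpansiveAt_half_of_eventually (hp : p ≠ 0) (hc : c ≤ 2)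
    (hTy : T y = y)
    (h : ∀ ε > 0, ∀ᶠ x in 𝓝 y,
      dist (T x) y ^ p + dist x (T x) ^ p ≤ (1 + ε) * dist x y ^ p) :
    AsymptoticallyFirmlyNonexpansiveAt p c (1 / 2) T y := by
  refine ⟨⟨by norm_num, by norm_num⟩, fun ε hε => ⟨_, h ε hε, fun x hx => ?_⟩⟩
  have hψ : c / 2 * dist x (T x) ^ p ≤ dist x (T x) ^ p :=
    mul_le_of_le_one_left (by positivity) (by linarith)
  rw [mem_ofPred_eq] at hx
  rw [transportDiscrepancy_of_fixed hp c hTy, hTy, dist_comm (T x) x]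
  linarith

theorem IsProx.asymptoticallyFirmlyNonexpansiveAt (hT : IsProx p lam f T) (hp : 1 < p)
    (hc : 0 < c) (hlam : 0 < lam) (hG : PUniformlyConvex G p c) (hf : ProperFun f)
    (hconv : GeodesicallyConvex f) (hκ : IsCAT G κ) (hy : y ∈ argmin f) {c' : ℝ} (hc' : c' ≤ 2) :
    AsymptoticallyFirmlyNonexpansiveAt p c' (1 / 2) T y := by
  have hp0 : p ≠ 0 := by linarith
  have hTy : T y = y := by
    have hfix := hT.argmin_eq_fixedPoints hp hlam hG.1 hf hconv
    exact hfix.subset hy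
  refine asymptoticallyFirmlyNonexpansiveAt_half_of_eventually hp0 hc' hTy fun ε hε => ?_
  cases subsingleton_or_nontrivial G
  · exact .of_forall fun x => by
      simp [hTy, Subsingleton.elim x y, Real.zero_rpow hp0]
  · exact hT.eventually_rpow_add_rpow_le (hG.two_le hp.le hc) hlam hG.1 hf hconv hκ hy hε

end AsymptoticFirmness

end PProx

theorem theorem4p1_general {G : Type*} [MetricSpace G] [CompleteSpace G]
    (p c lam : ℝ) (hp : 1 < p) (hc : 0 < c) (hc2 : c ≤ 2) (hlam : 0 < lam)
    (hG : PProx.PUniformlyConvex G p c)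
    (f : G → EReal) (hf : PProx.ProperFun f) (hconv : PProx.GeodesicallyConvex f)
    (hlsc : LowerSemicontinuous f) :
    ∃ T : G → G, PProx.IsProx p lam f T ∧
      PProx.argmin f = Function.fixedPoints T ∧
      (PProx.SymmetricPerpendicular G → PProx.QuasiStrictlyNonexpansive T) ∧
      (1 < c → ∀ y ∈ PProx.argmin f,
        PProx.AlmostFirmlyNonexpansiveAt p c (c * (c - 1) / (c * (c - 1) + 2))
          ((2 - c) / (c - 1)) T Set.univ y) ∧
      (∀ κ : ℝ, PProx.IsCAT G κ → ∀ y ∈ PProx.argmin f, ∀ c' ≤ 2,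
        PProx.AsymptoticallyFirmlyNonexpansiveAt p c' (1 / 2) T y) := by
  obtain ⟨T, hT⟩ := PProx.exists_isProx hp hc hlam hG hf hconv hlsc
  exact ⟨T, hT, hT.argmin_eq_fixedPoints hp hlam hG.1 hf hconv,
    hT.quasiStrictlyNonexpansive hp hc hlam hG hf hconv,
    fun hc1 _ hy => hT.almostFirmlyNonexpansiveAt hp hc1 hc2 hlam hG hf hconv hy,
    fun _ hκ _ hy _ hc' => hT.asymptoticallyFirmlyNonexpansiveAt hp hc hlam hG hf hconv hκ hy hc'⟩

theorem theorem4p1 {G : Type*} [MetricSpace G] [CompleteSpace G]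
    (p c lam : ℝ) (hp : 1 < p) (hc : 0 < c) (hc2 : c ≤ 2) (hlam : 0 < lam)
    (hG : PProx.PUniformlyConvex G p c)
    (f : G → EReal) (hf : PProx.ProperFun f) (hconv : PProx.GeodesicallyConvex f)
    (hlsc : LowerSemicontinuous f) :
    ∃ T : G → G, PProx.IsProx p lam f T ∧
      (PProx.SymmetricPerpendicular G →
        PProx.argmin f = Function.fixedPoints T ∧ PProx.QuasiStrictlyNonexpansive T) ∧
      (1 < c → ∀ y ∈ PProx.argmin f,
        PProx.AlmostFirmlyNonexpansiveAt p c (c * (c - 1) / (c * (c - 1) + 2))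
          ((2 - c) / (c - 1)) T Set.univ y) ∧
      (∀ κ : ℝ, PProx.IsCAT G κ → ∀ y ∈ PProx.argmin f, ∀ c' : ℝ, 0 < c' → c' ≤ 2 →
        PProx.AsymptoticallyFirmlyNonexpansiveAt p c' (1 / 2) T y) := by
  obtain ⟨T, hT, hfix, hquasi, halmost, hCAT⟩ :=
    theorem4p1_general p c lam hp hc hc2 hlam hG f hf hconv hlsc
  exact ⟨T, hT, fun hsymm => ⟨hfix, hquasi hsymm⟩, halmost,
    fun κ hκ y hy c' _ hc' => hCAT κ hκ y hy c' hc'⟩
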